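/- Let $\alpha,\beta,\gamma\in\{1,2,\infty\}$, $\mu_1,\mu_2\ge 0$, $\rho\in\mathbb{R}$, $b\in\mathbb{R}^q$, $d\in\mathbb{R}^p$, and let $\mathcal{A}:\mathbb{R}^{m\times n}\to\mathbb{R}^q$ and $\mathcal{C}:\mathbb{R}^{m\times n}\to\mathbb{R}^p$ be linear with $\mathcal{A}$ surjective. Write $\sigma(X)\in\mathbb{R}^{\min\{m,n\}}$ for the vector of singular values of $X$. Suppose that the composite norm minimization problem $$\min_{X\in\mathbb{R}^{m\times n}}\ \mu_1\|\sigma(X)\|_\alpha+\mu_2\|\mathcal{C}(X)-d\|_\beta\quad\text{subject to}\quad \|\mathcal{A}(X)-b\|_\gamma\le\rho$$ has a unique optimal solution $X_*$. Let $\lambda^{(k)}>0$, $\epsilon^{(k)},\tau^{(k)},\xi^{(k)}$ ($k\ge1$) be real sequences, each decreasing monotonically to $0$, such that $\epsilon^{(k)}/(\lambda^{(k)})^2\le B$ for all $k\ge 1$ and some $B>0$, and $\tau^{(k)}/\lambda^{(k)}\to0$, $\xi^{(k)}/\lambda^{(k)}\to0$. Let $(X^{(k)},s^{(k)},y^{(k)})_{k\ge0}$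 be generated by the first-order augmented Lagrangian algorithm (FALC): $X^{(0)},s^{(0)},y^{(0)}$ are given, $\theta_1^{(1)}=0$, $\theta_2^{(1)}=0$, and for every $k\ge1$, with $$P^{(k)}(X,s,y)=\lambda^{(k)}\big(\mu_1\|\sigma(X)\|_\alpha+\mu_2\|s\|_\beta\big)+\tfrac12\|\mathcal{A}(X)+y-b-\lambda^{(k)}\theta_1^{(k)}\|_2^2+\tfrac12\|\mathcal{C}(X)+s-d-\lambda^{(k)}\theta_2^{(k)}\|_2^2$$ and $$\eta^{(k)}=\mu_1\|\sigma(X^{(0)})\|_\alpha+\mu_2\|\mathcal{C}(X^{(0)})-d\|_\beta+\tfrac{\lambda^{(k)}}{2}\big(\|\theta_1^{(k)}\|_2^2+\|\theta_2^{(k)}\|_2^2\big),$$ the point $(X^{(k)},s^{(k)},y^{(k)})\in\mathbb{R}^{m\times n}\times\mathbb{R}^p\times\mathbb{R}^q$ satisfies $\|y^{(k)}\|_\gamma\le\rho$ and at least one of the two conditions (a) $P^{(k)}(X^{(k)},s^{(k)},y^{(k)})\le\inf\{P^{(k)}(X,s,y): X\in\mathbb{R}^{m\times n},\ s\in\mathbb{R}^p,\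 \|y\|_\gamma\le\rho\}+\epsilon^{(k)}$; (b) there is a partial subgradient $(G,g)\in\partial_{X,s}P^{(k)}(\cdot,\cdot,\cdot)|_{(X^{(k)},s^{(k)},y^{(k)})}$, i.e. a subgradient of $P^{(k)}(\cdot,\cdot,y^{(k)})$ at $(X^{(k)},s^{(k)})$, with $\sqrt{\|G\|_F^2+\|g\|_2^2}\le\tau^{(k)}$; moreover $\rho\|v\|_{\gamma^*}+v^Ty^{(k)}\le\xi^{(k)}$ for $v=\nabla_yP^{(k)}(X^{(k)},s^{(k)},y^{(k)})$, where $\|\cdot\|_{\gamma^*}$ is the dual norm of $\|\cdot\|_\gamma$; and $\mu_1\|\sigma(X^{(k)})\|_\alpha\le\eta^{(k)}$; and $$\theta_1^{(k+1)}=\theta_1^{(k)}-\frac{\mathcal{A}(X^{(k)})+y^{(k)}-b}{\lambda^{(k)}},\qquad \theta_2^{(k+1)}=\theta_2^{(k)}-\frac{\mathcal{C}(X^{(k)})+s^{(k)}-d}{\lambda^{(k)}}.$$ Then the whole sequence converges: $\lim_{k\to\infty}X^{(k)}=X_*$. -/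

import Mathlib

open Filter Topology
open scoped ENNReal Gradient

noncomputable section

namespace FALC

/-- The `ℓ_r` norm of a real vector, `r ∈ {1, 2, ∞}`. -/
def vecNorm {l : ℕ} (r : ℝ≥0∞) (x : Fin l → ℝ) : ℝ :=
  ‖(WithLp.toLp r x : PiLp r (fun _ : Fin l => ℝ))‖

/-- The dual norm `max {⟨w, x⟩ : ‖w‖_r ≤ 1}` of `‖·‖_r`. -/
def dualVecNorm {l : ℕ} (r : ℝ≥0∞) (x : EuclideanSpace ℝ (Fin l)) : ℝ :=
  sSup {t : ℝ | ∃ w : EuclideanSpace ℝ (Fin l), vecNorm r w.ofLp ≤ 1 ∧ t = inner ℝ w x}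

/-- The vector `σ(X) ∈ ℝ^{min(m,n)}` of singular values of `X ∈ ℝ^{m×n}`. -/
def singVals {m n : ℕ} (X : Matrix (Fin m) (Fin n) ℝ) : Fin (min m n) → ℝ :=
  fun i => (Matrix.toEuclideanLin X).singularValues i

/-- The matrix norm `‖σ(X)‖_r`: nuclear (`r = 1`), Frobenius (`r = 2`) or operator (`r = ∞`). -/
def sigmaNorm {m n : ℕ} (r : ℝ≥0∞) (X : Matrix (Fin m) (Fin n) ℝ) : ℝ :=
  vecNorm r (singVals X)

/-- The inner product `⟨X, Y⟩ = Tr(Xᵀ Y)`. -/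
def matInner {m n : ℕ} (X Y : Matrix (Fin m) (Fin n) ℝ) : ℝ :=
  (X.transpose * Y).trace

section
open scoped Matrix.Norms.Frobenius

/-- The Frobenius norm. -/
def frobNorm {m n : ℕ} (X : Matrix (Fin m) (Fin n) ℝ) : ℝ := ‖X‖

end

/-- The data of the composite norm minimization problem
`min μ₁ ‖σ(X)‖_α + μ₂ ‖C(X) - d‖_β` subject to `‖A(X) - b‖_γ ≤ ρ`. -/
structure Problem (m n p q : ℕ) where
  A : Matrix (Fin m) (Fin n) ℝ →ₗ[ℝ] EuclideanSpace ℝ (Fin q)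
  C : Matrix (Fin m) (Fin n) ℝ →ₗ[ℝ] EuclideanSpace ℝ (Fin p)
  b : EuclideanSpace ℝ (Fin q)
  d : EuclideanSpace ℝ (Fin p)
  μ₁ : ℝ
  μ₂ : ℝ
  ρ : ℝ
  α : ℝ≥0∞
  β : ℝ≥0∞
  γ : ℝ≥0∞

namespace Problem

variable {m n p q : ℕ} (Q : Problem m n p q)

/-- The objective function `μ₁ ‖σ(X)‖_α + μ₂ ‖C(X) - d‖_β`. -/
def objective (X : Matrix (Fin m) (Fin n) ℝ) : ℝ :=
  Q.μ₁ * sigmaNorm Q.α X + Q.μ₂ * vecNorm Q.β (Q.C X - Q.d).ofLp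

/-- The feasible set `{X : ‖A(X) - b‖_γ ≤ ρ}`. -/
def feasible : Set (Matrix (Fin m) (Fin n) ℝ) :=
  {X | vecNorm Q.γ (Q.A X - Q.b).ofLp ≤ Q.ρ}

/-- `X` is an optimal solution of the composite norm minimization problem. -/
def IsOptimal (X : Matrix (Fin m) (Fin n) ℝ) : Prop :=
  X ∈ Q.feasible ∧ IsMinOn Q.objective Q.feasible X

/-- The smooth part
`f(X,s,y) = ½ ‖A(X) + y - b - λ θ₁‖₂² + ½ ‖C(X) + s - d - λ θ₂‖₂²` of a subproblem. -/
def smoothPart (lam : ℝ) (θ₁ : EuclideanSpace ℝ (Fin q)) (θ₂ : EuclideanSpace ℝ (Fin p))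
    (X : Matrix (Fin m) (Fin n) ℝ) (s : EuclideanSpace ℝ (Fin p))
    (y : EuclideanSpace ℝ (Fin q)) : ℝ :=
  1 / 2 * ‖Q.A X + y - Q.b - lam • θ₁‖ ^ 2 + 1 / 2 * ‖Q.C X + s - Q.d - lam • θ₂‖ ^ 2

/-- The augmented Lagrangian function `P(X,s,y) = λ (μ₁ ‖σ(X)‖_α + μ₂ ‖s‖_β) + f(X,s,y)`. -/
def augLag (lam : ℝ) (θ₁ : EuclideanSpace ℝ (Fin q)) (θ₂ : EuclideanSpace ℝ (Fin p))
    (X : Matrix (Fin m) (Fin n) ℝ) (s : EuclideanSpace ℝ (Fin p))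
    (y : EuclideanSpace ℝ (Fin q)) : ℝ :=
  lam * (Q.μ₁ * sigmaNorm Q.α X + Q.μ₂ * vecNorm Q.β s.ofLp) + Q.smoothPart lam θ₁ θ₂ X s y

/-- `(G, g) ∈ ∂_{X,s} P` at `(X, s, y)`: the subdifferential of `P(·, ·, y)` at `(X, s)`. -/
def IsPartialSubgradient (lam : ℝ) (θ₁ : EuclideanSpace ℝ (Fin q))
    (θ₂ : EuclideanSpace ℝ (Fin p)) (X : Matrix (Fin m) (Fin n) ℝ)
    (s : EuclideanSpace ℝ (Fin p)) (y : EuclideanSpace ℝ (Fin q))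
    (G : Matrix (Fin m) (Fin n) ℝ) (g : EuclideanSpace ℝ (Fin p)) : Prop :=
  ∀ (X' : Matrix (Fin m) (Fin n) ℝ) (s' : EuclideanSpace ℝ (Fin p)),
    Q.augLag lam θ₁ θ₂ X s y + matInner G (X' - X) + inner ℝ g (s' - s)
      ≤ Q.augLag lam θ₁ θ₂ X' s' y

/-- The partial gradient `∇_y P` at `(X, s, y)`. -/
def gradY (lam : ℝ) (θ₁ : EuclideanSpace ℝ (Fin q)) (θ₂ : EuclideanSpace ℝ (Fin p))
    (X : Matrix (Fin m) (Fin n) ℝ) (s : EuclideanSpace ℝ (Fin p))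
    (y : EuclideanSpace ℝ (Fin q)) : EuclideanSpace ℝ (Fin q) :=
  ∇ (fun y' => Q.augLag lam θ₁ θ₂ X s y') y

/-- Inner stopping condition (a): `(X, s, y)` minimizes `P` up to `ε` over all
`(X', s', y')` with `‖y'‖_γ ≤ ρ`. -/
def StopA (lam eps : ℝ) (θ₁ : EuclideanSpace ℝ (Fin q)) (θ₂ : EuclideanSpace ℝ (Fin p))
    (X : Matrix (Fin m) (Fin n) ℝ) (s : EuclideanSpace ℝ (Fin p))
    (y : EuclideanSpace ℝ (Fin q)) : Prop :=
  ∀ (X' : Matrix (Fin m) (Fin n) ℝ) (s' : EuclideanSpace ℝ (Fin p))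
    (y' : EuclideanSpace ℝ (Fin q)), vecNorm Q.γ y'.ofLp ≤ Q.ρ →
    Q.augLag lam θ₁ θ₂ X s y ≤ Q.augLag lam θ₁ θ₂ X' s' y' + eps

/-- Inner stopping condition (b): a small partial subgradient in `(X, s)`, approximate
optimality in `y`, and the bound `μ₁ ‖σ(X)‖_α ≤ η_k`. -/
def StopB (lam tau xi etak : ℝ) (θ₁ : EuclideanSpace ℝ (Fin q))
    (θ₂ : EuclideanSpace ℝ (Fin p)) (X : Matrix (Fin m) (Fin n) ℝ)
    (s : EuclideanSpace ℝ (Fin p)) (y : EuclideanSpace ℝ (Fin q)) : Prop :=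
  (∃ (G : Matrix (Fin m) (Fin n) ℝ) (g : EuclideanSpace ℝ (Fin p)),
      Q.IsPartialSubgradient lam θ₁ θ₂ X s y G g ∧
      Real.sqrt (frobNorm G ^ 2 + ‖g‖ ^ 2) ≤ tau) ∧
  Q.ρ * dualVecNorm Q.γ (Q.gradY lam θ₁ θ₂ X s y)
      + inner ℝ (Q.gradY lam θ₁ θ₂ X s y) y ≤ xi ∧
  Q.μ₁ * sigmaNorm Q.α X ≤ etak

/-- `(X^(k), s^(k), y^(k))`, with multipliers `θ₁^(k), θ₂^(k)`, is a run of the first-order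
augmented Lagrangian algorithm with parameters `(λ^(k), ε^(k), τ^(k), ξ^(k))`, `k ≥ 1`, started
at `(X^(0), s^(0), y^(0))`. The `k`-th inner solver may return any point with `‖y‖_γ ≤ ρ` that
passes one of the two stopping conditions; here
`η_k = μ₁ ‖σ(X^(0))‖_α + μ₂ ‖C(X^(0)) - d‖_β + (λ^(k)/2) (‖θ₁^(k)‖₂² + ‖θ₂^(k)‖₂²)`. -/
structure IsRun (lam eps tau xi : ℕ → ℝ) (X : ℕ → Matrix (Fin m) (Fin n) ℝ)
    (s : ℕ → EuclideanSpace ℝ (Fin p)) (y : ℕ → EuclideanSpace ℝ (Fin q))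
    (θ₁ : ℕ → EuclideanSpace ℝ (Fin q)) (θ₂ : ℕ → EuclideanSpace ℝ (Fin p)) : Prop where
  init₁ : θ₁ 1 = 0
  init₂ : θ₂ 1 = 0
  mem_ball : ∀ k, 1 ≤ k → vecNorm Q.γ (y k).ofLp ≤ Q.ρ
  inner_done : ∀ k, 1 ≤ k →
    Q.StopA (lam k) (eps k) (θ₁ k) (θ₂ k) (X k) (s k) (y k) ∨
    Q.StopB (lam k) (tau k) (xi k)
      (Q.objective (X 0) + lam k / 2 * (‖θ₁ k‖ ^ 2 + ‖θ₂ k‖ ^ 2))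
      (θ₁ k) (θ₂ k) (X k) (s k) (y k)
  update₁ : ∀ k, 1 ≤ k → θ₁ (k + 1) = θ₁ k - (lam k)⁻¹ • (Q.A (X k) + y k - Q.b)
  update₂ : ∀ k, 1 ≤ k → θ₂ (k + 1) = θ₂ k - (lam k)⁻¹ • (Q.C (X k) + s k - Q.d)

end Problem

/-- `u^(k) ↘ 0` for `k ≥ 1`: the sequence decreases monotonically to `0`. -/
def DecreasesToZero (u : ℕ → ℝ) : Prop :=
  AntitoneOn u (Set.Ici 1) ∧ Tendsto u atTop (𝓝 0)

/-- The conditions on the parameter sequences `(λ^(k), ε^(k), τ^(k), ξ^(k))`, `k ≥ 1`. -/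
structure ParamConditions (lam eps tau xi : ℕ → ℝ) : Prop where
  lam_pos : ∀ k, 1 ≤ k → 0 < lam k
  lam_decr : DecreasesToZero lam
  eps_decr : DecreasesToZero eps
  eps_bound : ∃ B : ℝ, 0 < B ∧ ∀ k, 1 ≤ k → eps k / lam k ^ 2 ≤ B
  tau_decr : DecreasesToZero tau
  xi_decr : DecreasesToZero xi
  tau_ratio : Tendsto (fun k => tau k / lam k) atTop (𝓝 0)
  xi_ratio : Tendsto (fun k => xi k / lam k) atTop (𝓝 0)

end FALC

end


/-
Split the problem as: minimize `φ(X, s) = μ₁ ‖σ(X)‖_α + μ₂ ‖s‖_β` subject to `T(X, s) + w = c`,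
where `T(X, s) = (A(X), C(X) + s)`, `c = (b, d)` and the slack `w = (y, 0)` lies in the closed
convex set `K` cut out by `‖y‖_γ ≤ ρ`. The updated multiplier `θ⁺` satisfies
`T z + w - c - λ θ = -λ θ⁺`. Testing either stopping criterion at `z + λ D`, with `T D` the unit
vector along `θ⁺`, bounds `‖θ⁺‖`, because `φ` is Lipschitz and `T` is surjective. Hence the distance
from `c - T z` to `K` is `O(λ)`, and comparing with the solution `z₀` gives
`φ(z) ≤ φ(z₀) + o(1) (1 + ‖z - z₀‖)`. The convex function
`h(z) = max (dist(c - T z, K)) (φ(z) - φ(z₀))` is positive away from the unique solution `z₀`, so by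
convexity it grows at least linearly outside each ball around `z₀`; since
`h(z) ≤ o(1) (1 + ‖z - z₀‖)` along the run, the iterates converge to `z₀`.

The convexity of `φ` rests on the triangle inequality for `‖σ(·)‖_r`: for Bessel systems `u`, `v`
(such as subfamilies of orthonormal bases), the numbers `⟪X uᵢ, vᵢ⟫` are obtained from `σ(X)` by a
matrix whose absolute row and column sums are at most `1`, hence
`‖(⟪X uᵢ, vᵢ⟫)ᵢ‖_r ≤ ‖σ(X)‖_r`, and singular systems attain equality.
-/

noncomputable section

namespace FALC

section ConvexGrowth

variable {E : Type*} [NormedAddCommGroup E] [NormedSpace ℝ E]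

theorem convexOn_infDist {K : Set E} (hK : Convex ℝ K) (hne : K.Nonempty) :
    ConvexOn ℝ Set.univ (Metric.infDist · K) := by
  refine ⟨convex_univ, fun x _ y _ a b ha hb hab => le_of_forall_pos_le_add fun δ hδ => ?_⟩
  obtain ⟨u, huK, hu⟩ := (Metric.infDist_lt_iff hne).1 (lt_add_of_pos_right (Metric.infDist x K) hδ)
  obtain ⟨v, hvK, hv⟩ := (Metric.infDist_lt_iff hne).1 (lt_add_of_pos_right (Metric.infDist y K) hδ)
  calc Metric.infDist (a • x + b • y) K
      ≤ dist (a • x + b • y) (a • u + b • v) :=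
        Metric.infDist_le_dist_of_mem (hK huK hvK ha hb hab)
    _ ≤ dist (a • x) (a • u) + dist (b • y) (b • v) := dist_add_add_le _ _ _ _
    _ = a * dist x u + b * dist y v := by
        rw [dist_smul₀, dist_smul₀, Real.norm_of_nonneg ha, Real.norm_of_nonneg hb]
    _ ≤ a * (Metric.infDist x K + δ) + b * (Metric.infDist y K + δ) := by gcongr
    _ = a • Metric.infDist x K + b • Metric.infDist y K + δ := by
        simp only [smul_eq_mul]
        linear_combination δ * hab

theorem exists_linear_growth_of_convexOn [ProperSpace E] {h : E → ℝ}
    (hconv : ConvexOn ℝ Set.univ h) (hcont : Continuous h) {z₀ : E} (hz₀ : h z₀ ≤ 0)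
    (hpos : ∀ z, z ≠ z₀ → 0 < h z) {δ : ℝ} (hδ : 0 < δ) :
    ∃ c > 0, ∀ z, δ ≤ ‖z - z₀‖ → c * ‖z - z₀‖ ≤ h z := by
  obtain ⟨c, hc, hsphere⟩ := (isCompact_sphere z₀ δ).exists_forall_le' hcont.continuousOn
    fun z hz => hpos z (Metric.ne_of_mem_sphere hz hδ.ne')
  refine ⟨c / δ, div_pos hc hδ, fun z hz => ?_⟩
  have hnorm : 0 < ‖z - z₀‖ := hδ.trans_le hz
  set r : ℝ := δ / ‖z - z₀‖
  have hr : 0 < r := div_pos hδ hnorm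
  have hr₁ : r ≤ 1 := (div_le_one hnorm).2 hz
  have hmem : (1 - r) • z₀ + r • z ∈ Metric.sphere z₀ δ := by
    rw [mem_sphere_iff_norm, show (1 - r) • z₀ + r • z - z₀ = r • (z - z₀) by module, norm_smul,
      Real.norm_of_nonneg hr.le, div_mul_cancel₀ _ hnorm.ne']
  have hchord : c ≤ r * h z :=
    calc c ≤ h ((1 - r) • z₀ + r • z) := hsphere _ hmem
      _ ≤ (1 - r) * h z₀ + r * h z :=
        hconv.2 (Set.mem_univ _) (Set.mem_univ _) (sub_nonneg.2 hr₁) hr.le (by ring)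
      _ ≤ r * h z := by
        linarith [mul_nonpos_of_nonneg_of_nonpos (sub_nonneg.2 hr₁) hz₀]
  calc c / δ * ‖z - z₀‖ ≤ r * h z / δ * ‖z - z₀‖ := by gcongr
    _ = h z := by simp only [r]; field_simp

theorem tendsto_of_convexOn_le [ProperSpace E] {h : E → ℝ} (hconv : ConvexOn ℝ Set.univ h)
    (hcont : Continuous h) {z₀ : E} (hz₀ : h z₀ ≤ 0) (hpos : ∀ z, z ≠ z₀ → 0 < h z) {ι : Type*}
    {l : Filter ι} {z : ι → E} {a e : ι → ℝ} (ha : Tendsto a l (𝓝 0)) (he : Tendsto e l (𝓝 0))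
    (hle : ∀ᶠ k in l, h (z k) ≤ a k * ‖z k - z₀‖ + e k) :
    Tendsto z l (𝓝 z₀) := by
  refine Metric.tendsto_nhds.2 fun δ hδ => ?_
  obtain ⟨c, hc, hgrowth⟩ := exists_linear_growth_of_convexOn hconv hcont hz₀ hpos hδ
  filter_upwards [ha.eventually_lt_const (half_pos hc),
    he.eventually_lt_const (mul_pos (half_pos hc) hδ), hle] with k hak hek hk
  rw [dist_eq_norm]
  by_contra! hfar
  have hslope : a k * ‖z k - z₀‖ ≤ c / 2 * ‖z k - z₀‖ := by gcongr
  have hdist : c / 2 * δ ≤ c / 2 * ‖z k - z₀‖ := by gcongr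
  linarith [hgrowth (z k) hfar]

end ConvexGrowth

section AugmentedLagrangian

variable {E F : Type*} [NormedAddCommGroup E] [NormedSpace ℝ E] [NormedAddCommGroup F]
  [InnerProductSpace ℝ F]

/-- The augmented Lagrangian, scaled by the penalty parameter `lam`, of the problem of minimizing
`φ z` subject to `T z + w = c` and a constraint on the slack `w`, with multiplier `θ`. -/
def augmentedLagrangian (φ : E → ℝ) (T : E →ₗ[ℝ] F) (c : F) (lam : ℝ) (θ : F) (z : E) (w : F) :
    ℝ :=
  lam * φ z + 1 / 2 * ‖T z + w - c - lam • θ‖ ^ 2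

/-- The multiplier `θ⁺` that the method of multipliers passes to the next subproblem. -/
def multiplierUpdate (T : E →ₗ[ℝ] F) (c : F) (lam : ℝ) (θ : F) (z : E) (w : F) : F :=
  θ - lam⁻¹ • (T z + w - c)

/-- `(z, w)` minimizes the augmented Lagrangian over `w ∈ K` up to `ε`. -/
def IsApproxMinimizer (φ : E → ℝ) (T : E →ₗ[ℝ] F) (c : F) (K : Set F) (lam ε : ℝ) (θ : F)
    (z : E) (w : F) : Prop :=
  ∀ z', ∀ w' ∈ K, augmentedLagrangian φ T c lam θ z w ≤ augmentedLagrangian φ T c lam θ z' w' + ε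

/-- `(z, w)` is stationary for the augmented Lagrangian over `w ∈ K`, up to slope `τ` in `z` and
up to `ξ` in the variational inequality for `w`. Stationarity in `z` is expressed without
subgradients, as a minimality property up to `τ * ‖z' - z‖`. -/
def IsApproxStationary (φ : E → ℝ) (T : E →ₗ[ℝ] F) (c : F) (K : Set F) (lam τ ξ : ℝ) (θ : F)
    (z : E) (w : F) : Prop :=
  (∀ z', augmentedLagrangian φ T c lam θ z w
      ≤ augmentedLagrangian φ T c lam θ z' w + τ * ‖z' - z‖) ∧
  ∀ w' ∈ K, inner ℝ (T z + w - c - lam • θ) (w - w') ≤ ξ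

/-- A run of the inexact method of multipliers, whose subproblems are solved up to accuracy
`B * lam k ^ 2` in value, or up to `τ k` and `ξ k` in the stationarity conditions. -/
structure IsInexactRun (φ : E → ℝ) (T : E →ₗ[ℝ] F) (c : F) (K : Set F) (B : ℝ)
    (lam τ ξ : ℕ → ℝ) (z : ℕ → E) (w θ : ℕ → F) : Prop where
  mem : ∀ k, w k ∈ K
  approx : ∀ k, IsApproxMinimizer φ T c K (lam k) (B * lam k ^ 2) (θ k) (z k) (w k) ∨
    IsApproxStationary φ T c K (lam k) (τ k) (ξ k) (θ k) (z k) (w k)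
  update : ∀ k, θ (k + 1) = multiplierUpdate T c (lam k) (θ k) (z k) (w k)

variable {φ : E → ℝ} {T : E →ₗ[ℝ] F} {c : F} {K : Set F} {lam τ ξ B : ℝ} {θ : F} {z z₀ : E} {w : F}

theorem residual_eq_smul_sub_multiplierUpdate (hlam : lam ≠ 0) :
    T z + w - c = lam • (θ - multiplierUpdate T c lam θ z w) := by
  rw [multiplierUpdate, sub_sub_cancel, smul_inv_smul₀ hlam]

theorem shifted_residual_eq_neg_smul_multiplierUpdate (hlam : lam ≠ 0) :
    T z + w - c - lam • θ = -(lam • multiplierUpdate T c lam θ z w) := by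
  rw [residual_eq_smul_sub_multiplierUpdate (θ := θ) hlam]
  module

theorem augmentedLagrangian_add (hlam : lam ≠ 0) (D : E) :
    augmentedLagrangian φ T c lam θ (z + D) w = augmentedLagrangian φ T c lam θ z w
      + lam * (φ (z + D) - φ z) - lam * inner ℝ (multiplierUpdate T c lam θ z w) (T D)
      + 1 / 2 * ‖T D‖ ^ 2 := by
  rw [augmentedLagrangian, augmentedLagrangian, map_add,
    show T z + T D + w - c - lam • θ = (T z + w - c - lam • θ) + T D by abel, norm_add_sq_real,
    shifted_residual_eq_neg_smul_multiplierUpdate hlam, inner_neg_left, real_inner_smul_left]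
  ring

theorem mul_le_augmentedLagrangian : lam * φ z ≤ augmentedLagrangian φ T c lam θ z w :=
  le_add_of_nonneg_right (by positivity)

theorem augmentedLagrangian_of_feasible :
    augmentedLagrangian φ T c lam θ z (c - T z) = lam * φ z + 1 / 2 * (lam ^ 2 * ‖θ‖ ^ 2) := by
  rw [augmentedLagrangian, add_sub_cancel, sub_self, zero_sub, norm_neg, norm_smul, mul_pow,
    Real.norm_eq_abs, sq_abs]

-- Both inexactness criteria are tested at `z + lam • D`: with this step length all the terms are
-- of order `lam ^ 2`, so the bound is uniform as `lam → 0`.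
theorem inner_multiplierUpdate_le {L : NNReal} (hφ : LipschitzWith L φ) (hlam : 0 < lam)
    (hz : ∀ z', augmentedLagrangian φ T c lam θ z w
      ≤ augmentedLagrangian φ T c lam θ z' w + τ * ‖z' - z‖ + B * lam ^ 2) (D : E) :
    inner ℝ (multiplierUpdate T c lam θ z w) (T D)
      ≤ (L + τ / lam) * ‖D‖ + B + 1 / 2 * ‖T D‖ ^ 2 := by
  have hmin := hz (z + lam • D)
  rw [augmentedLagrangian_add hlam.ne', add_sub_cancel_left, map_smul, real_inner_smul_right,
    norm_smul, norm_smul, Real.norm_of_nonneg hlam.le] at hmin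
  have hlip : φ (z + lam • D) - φ z ≤ L * (lam * ‖D‖) := by
    have h := (le_abs_self _).trans (hφ.dist_le_mul (z + lam • D) z)
    rwa [dist_eq_norm, add_sub_cancel_left, norm_smul, Real.norm_of_nonneg hlam.le] at h
  have hτ : τ / lam * lam = τ := div_mul_cancel₀ τ hlam.ne'
  refine le_of_mul_le_mul_left ?_ (pow_pos hlam 2)
  calc lam ^ 2 * inner ℝ (multiplierUpdate T c lam θ z w) (T D)
      ≤ lam * (φ (z + lam • D) - φ z) + τ * (lam * ‖D‖) + B * lam ^ 2
        + 1 / 2 * (lam * ‖T D‖) ^ 2 := by linarith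
    _ ≤ lam * (L * (lam * ‖D‖)) + τ * (lam * ‖D‖) + B * lam ^ 2
        + 1 / 2 * (lam * ‖T D‖) ^ 2 := by gcongr
    _ = lam ^ 2 * ((L + τ / lam) * ‖D‖ + B + 1 / 2 * ‖T D‖ ^ 2) := by
        linear_combination -(lam * ‖D‖) * hτ

theorem norm_multiplierUpdate_le {L : NNReal} (hφ : LipschitzWith L φ) (hlam : 0 < lam)
    (hz : ∀ z', augmentedLagrangian φ T c lam θ z w
      ≤ augmentedLagrangian φ T c lam θ z' w + τ * ‖z' - z‖ + B * lam ^ 2)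
    {κ : ℝ} (hB : 0 ≤ B) (hκ : 0 ≤ κ) (hT : ∀ v, ∃ D, T D = v ∧ ‖D‖ ≤ κ * ‖v‖) :
    ‖multiplierUpdate T c lam θ z w‖ ≤ (L + |τ / lam|) * κ + B + 1 / 2 := by
  set θ' := multiplierUpdate T c lam θ z w
  rcases eq_or_ne θ' 0 with h0 | h0
  · rw [h0, norm_zero]
    positivity
  have hunit : ‖‖θ'‖⁻¹ • θ'‖ = 1 := norm_smul_inv_norm h0
  obtain ⟨D, hD, hDκ⟩ := hT (‖θ'‖⁻¹ • θ')
  rw [hunit, mul_one] at hDκ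
  calc ‖θ'‖ = inner ℝ θ' (T D) := by
        rw [hD, real_inner_smul_right, real_inner_self_eq_norm_sq, pow_two,
          inv_mul_cancel_left₀ (norm_ne_zero_iff.2 h0)]
    _ ≤ (L + τ / lam) * ‖D‖ + B + 1 / 2 * ‖T D‖ ^ 2 := inner_multiplierUpdate_le hφ hlam hz D
    _ ≤ (L + |τ / lam|) * κ + B + 1 / 2 := by
        rw [hD, hunit, one_pow, mul_one]
        gcongr
        exact le_abs_self _

theorem nonneg_of_forall_add_mul_nonneg {a b : ℝ} (h : ∀ t, 0 < t → t ≤ 1 → 0 ≤ a + t * b) :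
    0 ≤ a := by
  have hlim : Tendsto (fun t : ℝ => a + t * b) (𝓝[>] 0) (𝓝 (a + 0 * b)) :=
    (Continuous.tendsto (by fun_prop) 0).mono_left nhdsWithin_le_nhds
  rw [zero_mul, add_zero] at hlim
  refine ge_of_tendsto hlim ?_
  filter_upwards [Ioo_mem_nhdsGT (zero_lt_one (α := ℝ))] with t ht
  exact h t ht.1 ht.2.le

theorem variational_inequality_of_augmentedLagrangian_le (hφ : ConvexOn ℝ Set.univ φ)
    (hlam : 0 < lam)
    (hz : ∀ z', augmentedLagrangian φ T c lam θ z w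
      ≤ augmentedLagrangian φ T c lam θ z' w + τ * ‖z' - z‖) (z' : E) :
    φ z + inner ℝ (multiplierUpdate T c lam θ z w) (T (z' - z)) ≤ φ z' + τ / lam * ‖z' - z‖ := by
  set D := z' - z
  set i := inner ℝ (multiplierUpdate T c lam θ z w) (T D)
  have hτ : τ / lam * lam = τ := div_mul_cancel₀ τ hlam.ne'
  suffices 0 ≤ lam * (φ z' + τ / lam * ‖D‖ - φ z - i) by
    linarith [nonneg_of_mul_nonneg_right this hlam]
  refine nonneg_of_forall_add_mul_nonneg (b := 1 / 2 * ‖T D‖ ^ 2) fun t ht₀ ht₁ => ?_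
  have hchord : φ (z + t • D) - φ z ≤ t * (φ z' - φ z) := by
    have h := hφ.2 (Set.mem_univ z) (Set.mem_univ z') (sub_nonneg.2 ht₁) ht₀.le (by ring)
    rw [show (1 - t) • z + t • z' = z + t • D by simp only [D]; module] at h
    simp only [smul_eq_mul] at h
    linarith
  have hmin := hz (z + t • D)
  rw [augmentedLagrangian_add hlam.ne', add_sub_cancel_left, map_smul, real_inner_smul_right,
    norm_smul, norm_smul, Real.norm_of_nonneg ht₀.le] at hmin
  refine nonneg_of_mul_nonneg_right (a := t) ?_ ht₀
  linarith [mul_le_mul_of_nonneg_left hchord hlam.le, congrArg (· * (t * ‖D‖)) hτ]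

theorem IsApproxMinimizer.mono {ε ε' : ℝ} (h : IsApproxMinimizer φ T c K lam ε θ z w)
    (hε : ε ≤ ε') : IsApproxMinimizer φ T c K lam ε' θ z w :=
  fun z' w' hw' => (h z' w' hw').trans (by gcongr)

theorem IsApproxMinimizer.le_add (hlam : 0 < lam)
    (h : IsApproxMinimizer φ T c K lam (B * lam ^ 2) θ z w) (hfeas : c - T z₀ ∈ K) :
    φ z ≤ φ z₀ + lam / 2 * ‖θ‖ ^ 2 + B * lam := by
  have hle := (mul_le_augmentedLagrangian (lam := lam)).trans (h z₀ _ hfeas)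
  rw [augmentedLagrangian_of_feasible] at hle
  refine le_of_mul_le_mul_left ?_ hlam
  linarith

theorem IsApproxStationary.le_add (hφ : ConvexOn ℝ Set.univ φ) (hlam : 0 < lam)
    (h : IsApproxStationary φ T c K lam τ ξ θ z w) (hfeas : c - T z₀ ∈ K) :
    φ z ≤ φ z₀ + τ / lam * ‖z - z₀‖ + lam / 2 * ‖θ‖ ^ 2 + ξ / lam := by
  have hvar := variational_inequality_of_augmentedLagrangian_le hφ hlam h.1 z₀
  have hslack := h.2 _ hfeas
  set θ' := multiplierUpdate T c lam θ z w
  have hres : T z + w - c = lam • (θ - θ') := residual_eq_smul_sub_multiplierUpdate hlam.ne'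
  rw [shifted_residual_eq_neg_smul_multiplierUpdate hlam.ne', inner_neg_left,
    real_inner_smul_left] at hslack
  have hslack' : -inner ℝ θ' (w - (c - T z₀)) ≤ ξ / lam := by
    rw [le_div_iff₀ hlam]
    linarith
  have hsplit : inner ℝ θ' (T (z₀ - z))
      = inner ℝ θ' (w - (c - T z₀)) - lam * (inner ℝ θ' θ - ‖θ'‖ ^ 2) := by
    rw [← real_inner_self_eq_norm_sq, ← inner_sub_right, ← real_inner_smul_right, ← hres,
      ← inner_sub_right, map_sub]
    congr 1
    abel
  have hyoung : lam * (inner ℝ θ' θ - ‖θ'‖ ^ 2) ≤ lam * (1 / 2 * ‖θ‖ ^ 2) := by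
    have hsq := norm_sub_sq_real θ' θ
    gcongr
    nlinarith [sq_nonneg ‖θ' - θ‖, sq_nonneg ‖θ'‖]
  rw [norm_sub_rev z₀ z] at hvar
  linarith

namespace IsInexactRun

variable {lam τ ξ : ℕ → ℝ} {z : ℕ → E} {w θ : ℕ → F}

theorem exists_norm_multiplier_le [FiniteDimensional ℝ E]
    (h : IsInexactRun φ T c K B lam τ ξ z w θ) {L : NNReal} (hφ : LipschitzWith L φ)
    (hT : Function.Surjective T) (hB : 0 ≤ B) (hlam : ∀ k, 0 < lam k)
    (hτ : Tendsto (fun k => τ k / lam k) atTop (𝓝 0)) :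
    ∃ M, ∀ k, ‖θ k‖ ≤ M := by
  have : CompleteSpace E := FiniteDimensional.complete ℝ E
  have : FiniteDimensional ℝ F := Module.Finite.of_surjective T hT
  have : CompleteSpace F := FiniteDimensional.complete ℝ F
  obtain ⟨κ, hκ, hpre⟩ := T.toContinuousLinearMap.exists_preimage_norm_le hT
  obtain ⟨R, hR⟩ := hτ.abs.bddAbove_range
  have hR' : ∀ k, |τ k / lam k| ≤ R := fun k => hR (Set.mem_range_self k)
  have hR₀ : 0 ≤ R := (abs_nonneg _).trans (hR' 0)
  have hsucc : ∀ k, ‖θ (k + 1)‖ ≤ (L + R) * κ + B + 1 / 2 := fun k => by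
    rw [h.update]
    have hBk : 0 ≤ B * lam k ^ 2 := by positivity
    rcases h.approx k with ha | hb
    · refine (norm_multiplierUpdate_le (τ := 0) hφ (hlam k) (fun z' => ?_) hB hκ.le hpre).trans ?_
      · simpa using ha z' _ (h.mem k)
      · rw [zero_div, abs_zero]
        gcongr
    · refine (norm_multiplierUpdate_le (τ := τ k) hφ (hlam k) (fun z' => ?_) hB hκ.le hpre).trans ?_
      · exact (hb.1 z').trans (le_add_of_nonneg_right hBk)
      · gcongr
        exact hR' k
  refine ⟨max ‖θ 0‖ ((L + R) * κ + B + 1 / 2), fun k => ?_⟩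
  cases k with
  | zero => exact le_max_left _ _
  | succ k => exact (hsucc k).trans (le_max_right _ _)

theorem infDist_le (h : IsInexactRun φ T c K B lam τ ξ z w θ) {M : ℝ} (hM : ∀ k, ‖θ k‖ ≤ M)
    (hlam : ∀ k, 0 < lam k) (k : ℕ) : Metric.infDist (c - T (z k)) K ≤ 2 * M * lam k :=
  calc Metric.infDist (c - T (z k)) K ≤ dist (c - T (z k)) (w k) :=
        Metric.infDist_le_dist_of_mem (h.mem k)
    _ = ‖lam k • (θ k - θ (k + 1))‖ := by
        rw [h.update, ← residual_eq_smul_sub_multiplierUpdate (hlam k).ne', dist_comm, dist_eq_norm]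
        congr 1
        abel
    _ ≤ lam k * (M + M) := by
        rw [norm_smul, Real.norm_of_nonneg (hlam k).le]
        gcongr
        · exact (hlam k).le
        · exact (norm_sub_le _ _).trans (add_le_add (hM _) (hM _))
    _ = 2 * M * lam k := by ring

theorem objective_le (h : IsInexactRun φ T c K B lam τ ξ z w θ) (hφ : ConvexOn ℝ Set.univ φ)
    (hB : 0 ≤ B) {M : ℝ} (hM : ∀ k, ‖θ k‖ ≤ M) (hlam : ∀ k, 0 < lam k) (hfeas : c - T z₀ ∈ K)
    (k : ℕ) :
    φ (z k) ≤ φ z₀ + |τ k / lam k| * ‖z k - z₀‖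
      + (lam k / 2 * M ^ 2 + B * lam k + |ξ k / lam k|) := by
  have hk := hlam k
  have hθ : lam k / 2 * ‖θ k‖ ^ 2 ≤ lam k / 2 * M ^ 2 := by gcongr; exact hM k
  have hBk : 0 ≤ B * lam k := by positivity
  rcases h.approx k with ha | hb
  · have hτ : 0 ≤ |τ k / lam k| * ‖z k - z₀‖ := by positivity
    linarith [ha.le_add hk hfeas, abs_nonneg (ξ k / lam k)]
  · have hτ : τ k / lam k * ‖z k - z₀‖ ≤ |τ k / lam k| * ‖z k - z₀‖ := by
      gcongr
      exact le_abs_self _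
    linarith [hb.le_add hφ hk hfeas, le_abs_self (ξ k / lam k)]

theorem tendsto [FiniteDimensional ℝ E]
    (h : IsInexactRun φ T c K B lam τ ξ z w θ) {L : NNReal} (hφ : LipschitzWith L φ)
    (hconv : ConvexOn ℝ Set.univ φ) (hK : IsClosed K) (hKconv : Convex ℝ K)
    (hT : Function.Surjective T) (hfeas : c - T z₀ ∈ K)
    (hunique : ∀ z, c - T z ∈ K → φ z ≤ φ z₀ → z = z₀) (hB : 0 ≤ B) (hlam : ∀ k, 0 < lam k)
    (hlam₀ : Tendsto lam atTop (𝓝 0)) (hτ : Tendsto (fun k => τ k / lam k) atTop (𝓝 0))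
    (hξ : Tendsto (fun k => ξ k / lam k) atTop (𝓝 0)) :
    Tendsto z atTop (𝓝 z₀) := by
  have : ProperSpace E := FiniteDimensional.proper ℝ E
  obtain ⟨M, hM⟩ := h.exists_norm_multiplier_le hφ hT hB hlam hτ
  have hM₀ : 0 ≤ M := (norm_nonneg _).trans (hM 0)
  have hne : K.Nonempty := ⟨_, hfeas⟩
  have hdist : ConvexOn ℝ Set.univ fun z => Metric.infDist (c - T z) K :=
    (convexOn_infDist hKconv hne).comp_affineMap
      (AffineMap.const ℝ E c - T.toAffineMap)
  have hgap : ConvexOn ℝ Set.univ fun z => max (Metric.infDist (c - T z) K) (φ z - φ z₀) :=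
    hdist.sup (hconv.sub (concaveOn_const (φ z₀) convex_univ))
  have hcont : Continuous fun z => max (Metric.infDist (c - T z) K) (φ z - φ z₀) :=
    ((Metric.continuous_infDist_pt K).comp
      (continuous_const.sub T.continuous_of_finiteDimensional)).max
      (hφ.continuous.sub continuous_const)
  refine tendsto_of_convexOn_le hgap hcont (a := fun k => |τ k / lam k|)
    (e := fun k => 2 * M * lam k + (lam k / 2 * M ^ 2 + B * lam k + |ξ k / lam k|))
    ?_ ?_ ?_ ?_ (Eventually.of_forall fun k => max_le ?_ ?_)
  · simp [Metric.infDist_zero_of_mem hfeas]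
  · intro z hz
    by_contra! hle
    refine hz (hunique z ?_ (sub_nonpos.1 ((le_max_right _ _).trans hle)))
    exact (hK.mem_iff_infDist_zero hne).2
      (((le_max_left _ _).trans hle).antisymm Metric.infDist_nonneg)
  · simpa using hτ.abs
  · simpa using (hlam₀.const_mul (2 * M)).add
      ((((hlam₀.div_const 2).mul_const (M ^ 2)).add (hlam₀.const_mul B)).add hξ.abs)
  · have hk := hlam k
    exact (h.infDist_le hM hlam k).trans <|
      le_add_of_nonneg_of_le (by positivity) (le_add_of_nonneg_right (by positivity))
  · have hk : 0 ≤ 2 * M * lam k := mul_nonneg (by positivity) (hlam k).le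
    linarith [h.objective_le hconv hB hM hlam hfeas k]

end IsInexactRun

end AugmentedLagrangian

section SingularValues

section Bessel

variable {ι E : Type*} [Fintype ι] [NormedAddCommGroup E] [InnerProductSpace ℝ E]

/-- A finite family of vectors satisfying Bessel's inequality. Orthonormal families do, and, unlike
them, they may be padded with zero vectors. -/
def IsBessel (u : ι → E) : Prop :=
  ∀ x, ∑ i, inner ℝ x (u i) ^ 2 ≤ ‖x‖ ^ 2

theorem isBessel_of_pairwise_inner_eq_zero {u : ι → E}
    (horth : Pairwise fun i j => inner ℝ (u i) (u j) = 0) (hnorm : ∀ i, ‖u i‖ ≤ 1) :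
    IsBessel u := by
  intro x
  set P := ∑ i, inner ℝ x (u i) • u i
  have hP : ∀ y, inner ℝ y P = ∑ i, inner ℝ x (u i) * inner ℝ y (u i) := fun y => by
    simp only [P, inner_sum, real_inner_smul_right]
  have hPu : ∀ j, inner ℝ P (u j) = inner ℝ x (u j) * ‖u j‖ ^ 2 := fun j => by
    rw [real_inner_comm, hP, Finset.sum_eq_single_of_mem j (Finset.mem_univ j) fun i _ hij => by
      rw [horth hij.symm, mul_zero], real_inner_self_eq_norm_sq]
  have hxP : inner ℝ x P = ∑ i, inner ℝ x (u i) ^ 2 := by simp only [hP, pow_two]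
  have hPP : ‖P‖ ^ 2 ≤ ∑ i, inner ℝ x (u i) ^ 2 := by
    rw [← real_inner_self_eq_norm_sq, hP]
    refine Finset.sum_le_sum fun i _ => ?_
    rw [hPu, ← mul_assoc, ← pow_two]
    exact mul_le_of_le_one_right (sq_nonneg _) (pow_le_one₀ (norm_nonneg _) (hnorm i))
  linarith [norm_sub_sq_real x P, sq_nonneg ‖x - P‖]

theorem IsBessel.norm_le_one {u : ι → E} (hu : IsBessel u) (i : ι) : ‖u i‖ ≤ 1 := by
  have h : (‖u i‖ ^ 2) ^ 2 ≤ ‖u i‖ ^ 2 := by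
    rw [← real_inner_self_eq_norm_sq]
    calc inner ℝ (u i) (u i) ^ 2 ≤ ∑ j, inner ℝ (u i) (u j) ^ 2 :=
          Finset.single_le_sum (fun j _ => sq_nonneg (inner ℝ (u i) (u j))) (Finset.mem_univ i)
      _ ≤ inner ℝ (u i) (u i) := by rw [real_inner_self_eq_norm_sq]; exact hu (u i)
  by_contra! hlt
  nlinarith [one_lt_pow₀ hlt two_ne_zero]

theorem IsBessel.comp {κ : Type*} [Fintype κ] {u : ι → E} (hu : IsBessel u) {g : κ → ι}
    (hg : Function.Injective g) : IsBessel fun k => u (g k) := fun x =>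
  calc ∑ k, inner ℝ x (u (g k)) ^ 2
      = ∑ i ∈ Finset.univ.map ⟨g, hg⟩, inner ℝ x (u i) ^ 2 := by
        rw [Finset.sum_map, Function.Embedding.coeFn_mk]
    _ ≤ ∑ i, inner ℝ x (u i) ^ 2 :=
        Finset.sum_le_univ_sum_of_nonneg fun _ => sq_nonneg _
    _ ≤ ‖x‖ ^ 2 := hu x

variable {F : Type*} [NormedAddCommGroup F] [InnerProductSpace ℝ F]

theorem IsBessel.sum_abs_inner_mul_abs_inner_le {u : ι → E} {v : ι → F} (hu : IsBessel u)
    (hv : IsBessel v) (x : E) (y : F) :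
    ∑ i, |inner ℝ x (u i)| * |inner ℝ y (v i)| ≤ ‖x‖ * ‖y‖ :=
  calc ∑ i, |inner ℝ x (u i)| * |inner ℝ y (v i)|
      ≤ √(∑ i, |inner ℝ x (u i)| ^ 2) * √(∑ i, |inner ℝ y (v i)| ^ 2) :=
        Real.sum_mul_le_sqrt_mul_sqrt _ _ _
    _ ≤ ‖x‖ * ‖y‖ := by
        simp only [sq_abs]
        gcongr <;> apply Real.sqrt_le_iff.2
        exacts [⟨norm_nonneg x, hu x⟩, ⟨norm_nonneg y, hv y⟩]

end Bessel

theorem norm_toLp_le_of_substochastic {ι κ : Type*} [Fintype ι] [Fintype κ] {p : ℝ≥0∞}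
    (hp : 1 ≤ p) {a : ι → κ → ℝ} (ha : ∀ i k, 0 ≤ a i k) (hrow : ∀ i, ∑ k, a i k ≤ 1)
    (hcol : ∀ k, ∑ i, a i k ≤ 1) {x : κ → ℝ} (hx : ∀ k, 0 ≤ x k) {w : ι → ℝ}
    (hw : ∀ i, |w i| ≤ ∑ k, a i k * x k) :
    ‖(WithLp.toLp p w : PiLp p fun _ => ℝ)‖ ≤ ‖(WithLp.toLp p x : PiLp p fun _ => ℝ)‖ := by
  have : Fact (1 ≤ p) := ⟨hp⟩
  rcases eq_or_ne p ∞ with rfl | hp_top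
  · rw [PiLp.norm_toLp, PiLp.norm_toLp, pi_norm_le_iff_of_nonneg (norm_nonneg _)]
    intro i
    calc |w i| ≤ ∑ k, a i k * x k := hw i
      _ ≤ ∑ k, a i k * ‖x‖ := by
        gcongr with k
        · exact ha i k
        · exact (le_abs_self _).trans (norm_le_pi_norm x k)
      _ ≤ ‖x‖ := by
        rw [← Finset.sum_mul]
        exact mul_le_of_le_one_left (norm_nonneg _) (hrow i)
  have hq : 1 ≤ p.toReal := by simpa using ENNReal.toReal_mono hp_top hp
  have hq₀ : 0 < p.toReal := one_pos.trans_le hq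
  have hjensen : ∀ i, |w i| ^ p.toReal ≤ ∑ k, a i k * x k ^ p.toReal := fun i => by
    have hsum : 0 ≤ ∑ k, a i k * x k ^ p.toReal :=
      Finset.sum_nonneg fun k _ => mul_nonneg (ha i k) (Real.rpow_nonneg (hx k) _)
    rw [← Real.le_rpow_inv_iff_of_pos (abs_nonneg _) hsum hq₀]
    calc |w i| ≤ ∑ k, a i k * x k := hw i
      _ ≤ (∑ k, a i k) ^ (1 - p.toReal⁻¹) * (∑ k, a i k * x k ^ p.toReal) ^ p.toReal⁻¹ :=
        Real.inner_le_weight_mul_Lp_of_nonneg _ hq _ _ (ha i) hx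
      _ ≤ (∑ k, a i k * x k ^ p.toReal) ^ p.toReal⁻¹ :=
        mul_le_of_le_one_left (Real.rpow_nonneg hsum _) <|
          Real.rpow_le_one (Finset.sum_nonneg fun k _ => ha i k) (hrow i)
            (sub_nonneg.2 (inv_le_one_of_one_le₀ hq))
  rw [PiLp.norm_eq_sum hq₀, PiLp.norm_eq_sum hq₀]
  refine Real.rpow_le_rpow (by positivity) ?_ (by positivity)
  calc ∑ i, |w i| ^ p.toReal ≤ ∑ i, ∑ k, a i k * x k ^ p.toReal :=
        Finset.sum_le_sum fun i _ => hjensen i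
    _ = ∑ k, (∑ i, a i k) * x k ^ p.toReal := by
        rw [Finset.sum_comm]
        simp only [Finset.sum_mul]
    _ ≤ ∑ k, |x k| ^ p.toReal := Finset.sum_le_sum fun k _ => by
        rw [abs_of_nonneg (hx k)]
        exact mul_le_of_le_one_left (Real.rpow_nonneg (hx k) _) (hcol k)

section Decomposition

variable {E F : Type*} [NormedAddCommGroup E] [InnerProductSpace ℝ E] [FiniteDimensional ℝ E]
  [NormedAddCommGroup F] [InnerProductSpace ℝ F] [FiniteDimensional ℝ F]

theorem exists_orthonormalBasis_inner_map_map (T : E →ₗ[ℝ] F) :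
    ∃ e : OrthonormalBasis (Fin (Module.finrank ℝ E)) ℝ E, ∀ i j,
      inner ℝ (T (e i)) (T (e j)) = if i = j then T.singularValues i ^ 2 else 0 := by
  set e := T.isSymmetric_adjoint_comp_self.eigenvectorBasis rfl
  refine ⟨e, fun i j => ?_⟩
  have heig : (T.adjoint ∘ₗ T) (e j) = T.singularValues j ^ 2 • e j := by
    rw [T.sq_singularValues_fin rfl]
    exact T.isSymmetric_adjoint_comp_self.apply_eigenvectorBasis rfl j
  rw [← LinearMap.adjoint_inner_right, ← LinearMap.comp_apply, heig, real_inner_smul_right,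
    orthonormal_iff_ite.1 e.orthonormal]
  split_ifs with hij
  · rw [hij, mul_one]
  · rw [mul_zero]

theorem exists_orthonormalBasis_map_eq_smul (T : E →ₗ[ℝ] F) :
    ∃ (e : OrthonormalBasis (Fin (Module.finrank ℝ E)) ℝ E) (f : Fin (Module.finrank ℝ E) → F),
      IsBessel f ∧ (∀ k, T (e k) = T.singularValues k • f k) ∧
      ∀ k, inner ℝ (T (e k)) (f k) = T.singularValues k := by
  obtain ⟨e, he⟩ := exists_orthonormalBasis_inner_map_map T
  have hnorm : ∀ k, ‖T (e k)‖ = T.singularValues k := fun k => by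
    rw [← sq_eq_sq₀ (norm_nonneg _) (T.singularValues_nonneg _), ← real_inner_self_eq_norm_sq, he,
      if_pos rfl]
  refine ⟨e, fun k => (T.singularValues k)⁻¹ • T (e k), isBessel_of_pairwise_inner_eq_zero
    (fun i j hij => ?_) fun k => ?_, fun k => ?_, fun k => ?_⟩
  · simp only [real_inner_smul_left, real_inner_smul_right, he, if_neg hij, mul_zero]
  · rw [norm_smul, hnorm, norm_inv, Real.norm_of_nonneg (T.singularValues_nonneg _)]
    exact inv_mul_le_one
  · by_cases hk : T.singularValues k = 0
    · rw [hk, zero_smul, ← norm_eq_zero, hnorm, hk]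
    · exact (smul_inv_smul₀ hk _).symm
  · rw [real_inner_smul_right, real_inner_self_eq_norm_sq, hnorm, pow_two]
    by_cases hk : T.singularValues k = 0
    · rw [hk, mul_zero, mul_zero]
    · exact inv_mul_cancel_left₀ hk _

theorem exists_singularValueDecomposition (T : E →ₗ[ℝ] F) {r : ℕ} (hr : r ≤ Module.finrank ℝ E)
    (hrank : Module.finrank ℝ T.range ≤ r) :
    ∃ (e : Fin r → E) (f : Fin r → F), IsBessel e ∧ IsBessel f ∧
      (∀ k : Fin r, inner ℝ (T (e k)) (f k) = T.singularValues k) ∧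
      ∀ x, T x = ∑ k : Fin r, (T.singularValues k * inner ℝ x (e k)) • f k := by
  obtain ⟨e, f, hf, hmap, hinner⟩ := exists_orthonormalBasis_map_eq_smul T
  have he : IsBessel e :=
    isBessel_of_pairwise_inner_eq_zero e.orthonormal.2 fun i => (e.orthonormal.1 i).le
  have hcast : Function.Injective (Fin.castLE hr) := Fin.castLE_injective hr
  refine ⟨fun k => e (k.castLE hr), fun k => f (k.castLE hr), he.comp hcast, hf.comp hcast,
    fun k => hinner (k.castLE hr), fun x => ?_⟩
  have htail : ∀ k ∉ Set.range (Fin.castLE hr),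
      (T.singularValues k * inner ℝ x (e k)) • f k = 0 := fun k hk => by
    have hrk : r ≤ k := le_of_not_gt fun hlt => hk ⟨⟨k, hlt⟩, rfl⟩
    rw [T.singularValues_eq_zero_iff_le_finrank_range.2 (hrank.trans hrk), zero_mul, zero_smul]
  calc T x = ∑ k, T (inner ℝ (e k) x • e k) := by rw [← map_sum, e.sum_repr']
    _ = ∑ k : Fin _, (T.singularValues k * inner ℝ x (e k)) • f k :=
        Finset.sum_congr rfl fun k _ => by
          rw [map_smul, hmap, smul_smul, mul_comm, real_inner_comm]
    _ = _ := (Fintype.sum_of_injective _ hcast _ _ htail fun _ => rfl).symm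

theorem norm_toLp_inner_map_le_norm_toLp_singularValues (T : E →ₗ[ℝ] F) {r : ℕ}
    (hr : r ≤ Module.finrank ℝ E) (hrank : Module.finrank ℝ T.range ≤ r) {p : ℝ≥0∞} (hp : 1 ≤ p)
    {ι : Type*} [Fintype ι] {u : ι → E} {v : ι → F} (hu : IsBessel u) (hv : IsBessel v) :
    ‖(WithLp.toLp p fun i => inner ℝ (T (u i)) (v i) : PiLp p fun _ => ℝ)‖
      ≤ ‖(WithLp.toLp p fun k : Fin r => T.singularValues k : PiLp p fun _ => ℝ)‖ := by
  obtain ⟨e, f, he, hf, -, hT⟩ := exists_singularValueDecomposition T hr hrank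
  refine norm_toLp_le_of_substochastic hp
    (a := fun i k => |inner ℝ (u i) (e k)| * |inner ℝ (v i) (f k)|) (fun i k => by positivity)
    (fun i => ?_) (fun k => ?_) (fun k => T.singularValues_nonneg k) fun i => ?_
  · exact (he.sum_abs_inner_mul_abs_inner_le hf _ _).trans
      (mul_le_one₀ (hu.norm_le_one i) (norm_nonneg _) (hv.norm_le_one i))
  · simp only [real_inner_comm (e k), real_inner_comm (f k)]
    exact (hu.sum_abs_inner_mul_abs_inner_le hv _ _).trans
      (mul_le_one₀ (he.norm_le_one k) (norm_nonneg _) (hf.norm_le_one k))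
  · rw [hT, sum_inner]
    refine (Finset.abs_sum_le_sum_abs _ _).trans (Finset.sum_le_sum fun k _ => ?_)
    rw [real_inner_smul_left, abs_mul, abs_mul, abs_of_nonneg (T.singularValues_nonneg k),
      real_inner_comm (v i)]
    exact le_of_eq (by ring)

end Decomposition

end SingularValues

section Norms

open scoped Matrix.Norms.Frobenius

/-- The `ℓ_r` norm as a seminorm on Euclidean space. -/
def vecSeminorm (l : ℕ) (r : ℝ≥0∞) [Fact (1 ≤ r)] : Seminorm ℝ (EuclideanSpace ℝ (Fin l)) :=
  (normSeminorm ℝ (PiLp r fun _ : Fin l => ℝ)).comp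
    ((WithLp.linearEquiv r ℝ (Fin l → ℝ)).symm.toLinearMap ∘ₗ
      (WithLp.linearEquiv 2 ℝ (Fin l → ℝ)).toLinearMap)

theorem vecSeminorm_apply {l : ℕ} {r : ℝ≥0∞} [Fact (1 ≤ r)] (x : EuclideanSpace ℝ (Fin l)) :
    vecSeminorm l r x = vecNorm r x.ofLp := rfl

theorem bddAbove_inner_of_vecNorm_le_one {l : ℕ} (r : ℝ≥0∞) [Fact (1 ≤ r)]
    (x : EuclideanSpace ℝ (Fin l)) :
    BddAbove {t : ℝ | ∃ w : EuclideanSpace ℝ (Fin l), vecNorm r w.ofLp ≤ 1 ∧ t = inner ℝ w x} := by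
  let f : PiLp r (fun _ : Fin l => ℝ) →L[ℝ] ℝ := LinearMap.toContinuousLinearMap
    (innerₛₗ ℝ x ∘ₗ (WithLp.linearEquiv 2 ℝ (Fin l → ℝ)).symm.toLinearMap ∘ₗ
      (WithLp.linearEquiv r ℝ (Fin l → ℝ)).toLinearMap)
  refine ⟨‖f‖, ?_⟩
  rintro _ ⟨w, hw, rfl⟩
  rw [real_inner_comm]
  exact (le_abs_self _).trans (f.unit_le_opNorm (WithLp.toLp r w.ofLp) hw)

theorem dualVecNorm_nonneg {l : ℕ} {r : ℝ≥0∞} [Fact (1 ≤ r)] (x : EuclideanSpace ℝ (Fin l)) :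
    0 ≤ dualVecNorm r x :=
  le_csSup (bddAbove_inner_of_vecNorm_le_one r x)
    ⟨0, by rw [← vecSeminorm_apply, map_zero]; exact zero_le_one, (inner_zero_left x).symm⟩

theorem inner_le_vecNorm_mul_dualVecNorm {l : ℕ} {r : ℝ≥0∞} [Fact (1 ≤ r)]
    (w x : EuclideanSpace ℝ (Fin l)) : inner ℝ w x ≤ vecNorm r w.ofLp * dualVecNorm r x := by
  have hnonneg : 0 ≤ vecNorm r w.ofLp := norm_nonneg _
  rcases hnonneg.eq_or_lt with ha | ha
  · have hlp : (WithLp.toLp r w.ofLp : PiLp r fun _ : Fin l => ℝ) = 0 := norm_eq_zero.1 ha.symm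
    have hw : w = 0 := (WithLp.ofLp_eq_zero 2).1 ((WithLp.toLp_eq_zero r).1 hlp)
    rw [← ha, hw, inner_zero_left, zero_mul]
  · have hunit : vecNorm r ((vecNorm r w.ofLp)⁻¹ • w).ofLp ≤ 1 := by
      rw [← vecSeminorm_apply, map_smul_eq_mul, vecSeminorm_apply, norm_inv,
        Real.norm_of_nonneg ha.le, inv_mul_cancel₀ ha.ne']
    have hle : inner ℝ ((vecNorm r w.ofLp)⁻¹ • w) x ≤ dualVecNorm r x :=
      le_csSup (bddAbove_inner_of_vecNorm_le_one r x) ⟨_, hunit, rfl⟩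
    rwa [real_inner_smul_left, inv_mul_le_iff₀ ha] at hle

variable {m n : ℕ}

theorem matInner_eq_inner (X Y : Matrix (Fin m) (Fin n) ℝ) :
    matInner X Y = inner ℝ
      (WithLp.toLp 2 fun i => WithLp.toLp 2 (X i) : PiLp 2 fun _ => EuclideanSpace ℝ (Fin n))
      (WithLp.toLp 2 fun i => WithLp.toLp 2 (Y i)) := by
  simp only [matInner, Matrix.trace, Matrix.diag, Matrix.mul_apply, Matrix.transpose_apply,
    PiLp.inner_apply, Real.inner_apply]
  exact Finset.sum_comm

theorem abs_matInner_le (X Y : Matrix (Fin m) (Fin n) ℝ) : |matInner X Y| ≤ ‖X‖ * ‖Y‖ := by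
  rw [matInner_eq_inner]
  exact abs_real_inner_le_norm _ _

theorem finrank_range_toEuclideanLin_le (X : Matrix (Fin m) (Fin n) ℝ) :
    Module.finrank ℝ (Matrix.toEuclideanLin X).range ≤ min m n :=
  le_min ((Submodule.finrank_le _).trans_eq (finrank_euclideanSpace_fin))
    ((LinearMap.finrank_range_le _).trans_eq finrank_euclideanSpace_fin)

theorem exists_isBessel_inner_eq_singVals (X : Matrix (Fin m) (Fin n) ℝ) :
    ∃ (e : Fin (min m n) → EuclideanSpace ℝ (Fin n)) (f : Fin (min m n) → EuclideanSpace ℝ (Fin m)),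
      IsBessel e ∧ IsBessel f ∧
        (fun k => inner ℝ (Matrix.toEuclideanLin X (e k)) (f k)) = singVals X := by
  obtain ⟨e, f, he, hf, hef, -⟩ := exists_singularValueDecomposition (Matrix.toEuclideanLin X)
    (by simp only [finrank_euclideanSpace_fin, min_le_right]) (finrank_range_toEuclideanLin_le X)
  exact ⟨e, f, he, hf, funext hef⟩

variable {r : ℝ≥0∞} [Fact (1 ≤ r)]

theorem vecNorm_inner_le_sigmaNorm (X : Matrix (Fin m) (Fin n) ℝ) {l : ℕ}
    {u : Fin l → EuclideanSpace ℝ (Fin n)} {v : Fin l → EuclideanSpace ℝ (Fin m)}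
    (hu : IsBessel u) (hv : IsBessel v) :
    vecNorm r (fun i => inner ℝ (Matrix.toEuclideanLin X (u i)) (v i)) ≤ sigmaNorm r X :=
  norm_toLp_inner_map_le_norm_toLp_singularValues _
    (by simp only [finrank_euclideanSpace_fin, min_le_right]) (finrank_range_toEuclideanLin_le X)
    Fact.out hu hv

theorem sigmaNorm_add_le (X Y : Matrix (Fin m) (Fin n) ℝ) :
    sigmaNorm r (X + Y) ≤ sigmaNorm r X + sigmaNorm r Y := by
  obtain ⟨e, f, he, hf, hef⟩ := exists_isBessel_inner_eq_singVals (X + Y)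
  calc sigmaNorm r (X + Y)
      = vecNorm r ((fun k => inner ℝ (Matrix.toEuclideanLin X (e k)) (f k))
          + fun k => inner ℝ (Matrix.toEuclideanLin Y (e k)) (f k)) := by
        rw [sigmaNorm, ← hef]
        congr 1
        ext k
        rw [map_add, LinearMap.add_apply, inner_add_left, Pi.add_apply]
    _ ≤ vecNorm r (fun k => inner ℝ (Matrix.toEuclideanLin X (e k)) (f k))
          + vecNorm r fun k => inner ℝ (Matrix.toEuclideanLin Y (e k)) (f k) :=
        norm_add_le (WithLp.toLp r _) (WithLp.toLp r _)
    _ ≤ sigmaNorm r X + sigmaNorm r Y :=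
        add_le_add (vecNorm_inner_le_sigmaNorm X he hf) (vecNorm_inner_le_sigmaNorm Y he hf)

theorem sigmaNorm_smul_le (a : ℝ) (X : Matrix (Fin m) (Fin n) ℝ) :
    sigmaNorm r (a • X) ≤ ‖a‖ * sigmaNorm r X := by
  obtain ⟨e, f, he, hf, hef⟩ := exists_isBessel_inner_eq_singVals (a • X)
  calc sigmaNorm r (a • X)
      = vecNorm r (a • fun k => inner ℝ (Matrix.toEuclideanLin X (e k)) (f k)) := by
        rw [sigmaNorm, ← hef]
        congr 1
        ext k
        rw [map_smul, LinearMap.smul_apply, real_inner_smul_left, Pi.smul_apply, smul_eq_mul]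
    _ = ‖a‖ * vecNorm r fun k => inner ℝ (Matrix.toEuclideanLin X (e k)) (f k) :=
        norm_smul a (WithLp.toLp r _)
    _ ≤ ‖a‖ * sigmaNorm r X := by
        gcongr
        exact vecNorm_inner_le_sigmaNorm X he hf

/-- The matrix norm `‖σ(X)‖_r` as a seminorm. -/
def sigmaSeminorm (m n : ℕ) (r : ℝ≥0∞) [Fact (1 ≤ r)] : Seminorm ℝ (Matrix (Fin m) (Fin n) ℝ) :=
  Seminorm.ofSMulLE (sigmaNorm r)
    (le_antisymm (by simpa using sigmaNorm_smul_le (r := r) 0 (0 : Matrix (Fin m) (Fin n) ℝ))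
      (norm_nonneg _))
    sigmaNorm_add_le sigmaNorm_smul_le

theorem continuous_seminorm {E : Type*} [NormedAddCommGroup E] [NormedSpace ℝ E]
    [FiniteDimensional ℝ E] (f : Seminorm ℝ E) : Continuous f :=
  continuousOn_univ.1 (f.convexOn.continuousOn isOpen_univ)

theorem exists_lipschitzWith_seminorm {E : Type*} [NormedAddCommGroup E] [NormedSpace ℝ E]
    [FiniteDimensional ℝ E] (f : Seminorm ℝ E) : ∃ L, LipschitzWith L f := by
  obtain ⟨L, hL, hf⟩ := f.bound_of_continuous_normedSpace (continuous_seminorm f)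
  refine ⟨⟨L, hL.le⟩, LipschitzWith.of_le_add_mul _ fun x y => ?_⟩
  rw [dist_eq_norm]
  have htri := map_add_le_add f y (x - y)
  rw [add_sub_cancel] at htri
  exact htri.trans (add_le_add_right (hf _) _)

end Norms

section CompositeNorm

open scoped Matrix.Norms.Frobenius

namespace Problem

variable {m n p q : ℕ} (Q : Problem m n p q)

/-- The linear map `(X, s) ↦ (A(X), C(X) + s)`, with which the problem reads: minimize
`μ₁ ‖σ(X)‖_α + μ₂ ‖s‖_β` subject to `constraintMap (X, s) + (y, 0) = (b, d)` and `‖y‖_γ ≤ ρ`. -/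
def constraintMap : Matrix (Fin m) (Fin n) ℝ × EuclideanSpace ℝ (Fin p) →ₗ[ℝ]
    WithLp 2 (EuclideanSpace ℝ (Fin q) × EuclideanSpace ℝ (Fin p)) :=
  (WithLp.linearEquiv 2 ℝ _).symm.toLinearMap ∘ₗ
    (Q.A ∘ₗ LinearMap.fst ℝ _ _).prod (Q.C ∘ₗ LinearMap.fst ℝ _ _ + LinearMap.snd ℝ _ _)

theorem constraintMap_apply (z : Matrix (Fin m) (Fin n) ℝ × EuclideanSpace ℝ (Fin p)) :
    Q.constraintMap z = WithLp.toLp 2 (Q.A z.1, Q.C z.1 + z.2) := rfl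

/-- The set of slacks `(y, 0)` with `‖y‖_γ ≤ ρ`. -/
def slackSet : Set (WithLp 2 (EuclideanSpace ℝ (Fin q) × EuclideanSpace ℝ (Fin p))) :=
  {w | vecNorm Q.γ w.fst.ofLp ≤ Q.ρ ∧ w.snd = 0}

/-- The penalty `μ₁ ‖σ(X)‖_α + μ₂ ‖s‖_β` of the split problem. -/
def penalty (z : Matrix (Fin m) (Fin n) ℝ × EuclideanSpace ℝ (Fin p)) : ℝ :=
  Q.μ₁ * sigmaNorm Q.α z.1 + Q.μ₂ * vecNorm Q.β z.2.ofLp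

theorem constraintMap_surjective (hA : Function.Surjective Q.A) :
    Function.Surjective Q.constraintMap := fun v => by
  obtain ⟨X, hX⟩ := hA v.fst
  refine ⟨(X, v.snd - Q.C X), ?_⟩
  rw [constraintMap_apply, hX, add_sub_cancel]
  rfl

theorem isClosed_slackSet [Fact (1 ≤ Q.γ)] : IsClosed Q.slackSet := by
  have hofLp : Continuous fun w : WithLp 2 (EuclideanSpace ℝ (Fin q) × EuclideanSpace ℝ (Fin p)) =>
      w.ofLp := WithLp.prod_continuous_ofLp 2 _ _
  exact (isClosed_le ((continuous_seminorm (vecSeminorm q Q.γ)).comp hofLp.fst)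
    continuous_const).inter (isClosed_eq hofLp.snd continuous_const)

theorem convex_slackSet [Fact (1 ≤ Q.γ)] : Convex ℝ Q.slackSet := by
  rintro w ⟨hw, hw₀⟩ w' ⟨hw', hw₀'⟩ a b ha hb hab
  have hball := (vecSeminorm q Q.γ).convexOn.convex_le Q.ρ ⟨Set.mem_univ _, hw⟩
    ⟨Set.mem_univ _, hw'⟩ ha hb hab
  refine ⟨hball.2, ?_⟩
  rw [WithLp.add_snd, WithLp.smul_snd, WithLp.smul_snd, hw₀, hw₀', smul_zero, smul_zero, add_zero]

theorem exists_seminorm_eq_penalty [Fact (1 ≤ Q.α)] [Fact (1 ≤ Q.β)] (hμ₁ : 0 ≤ Q.μ₁)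
    (hμ₂ : 0 ≤ Q.μ₂) :
    ∃ f : Seminorm ℝ (Matrix (Fin m) (Fin n) ℝ × EuclideanSpace ℝ (Fin p)), ⇑f = Q.penalty := by
  let a : NNReal := ⟨Q.μ₁, hμ₁⟩
  let b : NNReal := ⟨Q.μ₂, hμ₂⟩
  exact ⟨a • (sigmaSeminorm m n Q.α).comp (LinearMap.fst ℝ _ _) +
    b • (vecSeminorm p Q.β).comp (LinearMap.snd ℝ _ _), rfl⟩

theorem augLag_eq_augmentedLagrangian (lam : ℝ) (θ₁ y : EuclideanSpace ℝ (Fin q))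
    (θ₂ s : EuclideanSpace ℝ (Fin p)) (X : Matrix (Fin m) (Fin n) ℝ) :
    Q.augLag lam θ₁ θ₂ X s y = augmentedLagrangian Q.penalty Q.constraintMap
      (WithLp.toLp 2 (Q.b, Q.d)) lam (WithLp.toLp 2 (θ₁, θ₂)) (X, s) (WithLp.toLp 2 (y, 0)) := by
  rw [augLag, augmentedLagrangian, smoothPart, WithLp.prod_norm_sq_eq_of_L2]
  simp only [constraintMap_apply, penalty, WithLp.add_fst, WithLp.add_snd, WithLp.sub_fst,
    WithLp.sub_snd, WithLp.smul_fst, WithLp.smul_snd, WithLp.toLp_fst, WithLp.toLp_snd, add_zero]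
  ring

theorem gradY_eq (lam : ℝ) (θ₁ y : EuclideanSpace ℝ (Fin q)) (θ₂ s : EuclideanSpace ℝ (Fin p))
    (X : Matrix (Fin m) (Fin n) ℝ) :
    Q.gradY lam θ₁ θ₂ X s y = Q.A X + y - Q.b - lam • θ₁ := by
  refine HasGradientAt.gradient ?_
  rw [hasGradientAt_iff_hasFDerivAt]
  have hresidual : HasFDerivAt (fun y' => Q.A X + y' - Q.b - lam • θ₁)
      (ContinuousLinearMap.id ℝ _) y :=
    (((hasFDerivAt_id y).const_add _).sub_const _).sub_const _
  refine (((hresidual.norm_sq.const_mul (1 / 2)).add_const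
    (1 / 2 * ‖Q.C X + s - Q.d - lam • θ₂‖ ^ 2)).const_add
      (lam * (Q.μ₁ * sigmaNorm Q.α X + Q.μ₂ * vecNorm Q.β s.ofLp))).congr_fderiv ?_
  ext v
  simp

variable {Q} {lam eps tau xi eta B : ℝ} {θ₁ y : EuclideanSpace ℝ (Fin q)}
  {θ₂ s : EuclideanSpace ℝ (Fin p)} {X : Matrix (Fin m) (Fin n) ℝ}

theorem StopA.isApproxMinimizer (h : Q.StopA lam eps θ₁ θ₂ X s y) :
    IsApproxMinimizer Q.penalty Q.constraintMap (WithLp.toLp 2 (Q.b, Q.d)) Q.slackSet lam eps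
      (WithLp.toLp 2 (θ₁, θ₂)) (X, s) (WithLp.toLp 2 (y, 0)) := by
  rintro ⟨X', s'⟩ w ⟨hw, hw₀⟩
  have hslack : w = WithLp.toLp 2 (w.fst, 0) := by rw [← hw₀]; rfl
  rw [hslack, ← augLag_eq_augmentedLagrangian, ← augLag_eq_augmentedLagrangian]
  exact h X' s' w.fst hw

theorem IsPartialSubgradient.augLag_le {G : Matrix (Fin m) (Fin n) ℝ}
    {g : EuclideanSpace ℝ (Fin p)} (h : Q.IsPartialSubgradient lam θ₁ θ₂ X s y G g)
    (hle : Real.sqrt (frobNorm G ^ 2 + ‖g‖ ^ 2) ≤ tau) (X' : Matrix (Fin m) (Fin n) ℝ)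
    (s' : EuclideanSpace ℝ (Fin p)) :
    Q.augLag lam θ₁ θ₂ X s y
      ≤ Q.augLag lam θ₁ θ₂ X' s' y + 2 * tau * ‖(X', s') - (X, s)‖ := by
  have hG : ‖G‖ ≤ tau :=
    (Real.le_sqrt_of_sq_le (le_add_of_nonneg_right (sq_nonneg ‖g‖))).trans hle
  have hg : ‖g‖ ≤ tau :=
    (Real.le_sqrt_of_sq_le (le_add_of_nonneg_left (sq_nonneg (frobNorm G)))).trans hle
  have htau : 0 ≤ tau := (norm_nonneg g).trans hg
  have hX : -matInner G (X' - X) ≤ tau * ‖(X', s') - (X, s)‖ :=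
    (neg_le_abs _).trans <| (abs_matInner_le _ _).trans <|
      mul_le_mul hG (norm_fst_le ((X', s') - (X, s))) (norm_nonneg _) htau
  have hs : -inner ℝ g (s' - s) ≤ tau * ‖(X', s') - (X, s)‖ :=
    (neg_le_abs _).trans <| (abs_real_inner_le_norm _ _).trans <|
      mul_le_mul hg (norm_snd_le ((X', s') - (X, s))) (norm_nonneg _) htau
  linarith [h X' s']

theorem StopB.isApproxStationary [Fact (1 ≤ Q.γ)] (h : Q.StopB lam tau xi eta θ₁ θ₂ X s y) :
    IsApproxStationary Q.penalty Q.constraintMap (WithLp.toLp 2 (Q.b, Q.d)) Q.slackSet lam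
      (2 * tau) xi (WithLp.toLp 2 (θ₁, θ₂)) (X, s) (WithLp.toLp 2 (y, 0)) := by
  obtain ⟨⟨G, g, hsub, hle⟩, hdual, -⟩ := h
  refine ⟨fun z' => ?_, fun w ⟨hw, hw₀⟩ => ?_⟩
  · rw [← augLag_eq_augmentedLagrangian, ← augLag_eq_augmentedLagrangian]
    exact hsub.augLag_le hle z'.1 z'.2
  rw [gradY_eq] at hdual
  set v := Q.A X + y - Q.b - lam • θ₁
  have hholder : -inner ℝ v w.fst ≤ Q.ρ * dualVecNorm Q.γ v :=
    calc -inner ℝ v w.fst = inner ℝ (-w.fst) v := by rw [inner_neg_left, real_inner_comm]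
      _ ≤ vecNorm Q.γ (-w.fst).ofLp * dualVecNorm Q.γ v := inner_le_vecNorm_mul_dualVecNorm _ _
      _ ≤ Q.ρ * dualVecNorm Q.γ v := by
        rw [← vecSeminorm_apply, map_neg_eq_map, vecSeminorm_apply]
        exact mul_le_mul_of_nonneg_right hw (dualVecNorm_nonneg v)
  calc _ = inner ℝ v (y - w.fst) := by
        rw [WithLp.prod_inner_apply]
        simp [constraintMap_apply, hw₀, v]
    _ ≤ xi := by
        rw [inner_sub_right]
        linarith

theorem sub_constraintMap_mem_slackSet_iff [Fact (1 ≤ Q.γ)]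
    {z : Matrix (Fin m) (Fin n) ℝ × EuclideanSpace ℝ (Fin p)} :
    WithLp.toLp 2 (Q.b, Q.d) - Q.constraintMap z ∈ Q.slackSet
      ↔ z.1 ∈ Q.feasible ∧ z.2 = Q.d - Q.C z.1 := by
  have hfst : vecNorm Q.γ (Q.b - Q.A z.1).ofLp = vecNorm Q.γ (Q.A z.1 - Q.b).ofLp :=
    map_sub_rev (vecSeminorm q Q.γ) _ _
  have hsnd : Q.d - (Q.C z.1 + z.2) = 0 ↔ z.2 = Q.d - Q.C z.1 := by
    rw [sub_eq_zero, eq_sub_iff_add_eq', eq_comm]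
  exact and_congr (by rw [feasible, Set.mem_ofPred_eq, ← hfst]; rfl) hsnd

theorem penalty_mk_sub [Fact (1 ≤ Q.β)] (X : Matrix (Fin m) (Fin n) ℝ) :
    Q.penalty (X, Q.d - Q.C X) = Q.objective X := by
  rw [penalty, objective, ← vecSeminorm_apply, map_sub_rev, vecSeminorm_apply]

theorem IsOptimal.eq_of_penalty_le [Fact (1 ≤ Q.β)] [Fact (1 ≤ Q.γ)]
    {Xstar : Matrix (Fin m) (Fin n) ℝ} (hopt : Q.IsOptimal Xstar)
    (hunique : ∀ Y, Q.IsOptimal Y → Y = Xstar)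
    {z : Matrix (Fin m) (Fin n) ℝ × EuclideanSpace ℝ (Fin p)}
    (hz : WithLp.toLp 2 (Q.b, Q.d) - Q.constraintMap z ∈ Q.slackSet)
    (hle : Q.penalty z ≤ Q.penalty (Xstar, Q.d - Q.C Xstar)) :
    z = (Xstar, Q.d - Q.C Xstar) := by
  obtain ⟨X, s⟩ := z
  obtain ⟨hX, rfl : s = Q.d - Q.C X⟩ := sub_constraintMap_mem_slackSet_iff.1 hz
  rw [penalty_mk_sub, penalty_mk_sub] at hle
  rw [hunique X ⟨hX, fun Y hY => hle.trans (hopt.2 hY)⟩]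

theorem isInexactRun_of_stop [Fact (1 ≤ Q.γ)] {lam eps tau xi eta : ℕ → ℝ}
    (hlam : ∀ k, 1 ≤ k → 0 < lam k) (heps : ∀ k, 1 ≤ k → eps k / lam k ^ 2 ≤ B)
    {X : ℕ → Matrix (Fin m) (Fin n) ℝ} {s θ₂ : ℕ → EuclideanSpace ℝ (Fin p)}
    {y θ₁ : ℕ → EuclideanSpace ℝ (Fin q)}
    (hball : ∀ k, 1 ≤ k → vecNorm Q.γ (y k).ofLp ≤ Q.ρ)
    (hdone : ∀ k, 1 ≤ k →
      Q.StopA (lam k) (eps k) (θ₁ k) (θ₂ k) (X k) (s k) (y k) ∨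
      Q.StopB (lam k) (tau k) (xi k) (eta k) (θ₁ k) (θ₂ k) (X k) (s k) (y k))
    (hupdate₁ : ∀ k, 1 ≤ k → θ₁ (k + 1) = θ₁ k - (lam k)⁻¹ • (Q.A (X k) + y k - Q.b))
    (hupdate₂ : ∀ k, 1 ≤ k → θ₂ (k + 1) = θ₂ k - (lam k)⁻¹ • (Q.C (X k) + s k - Q.d)) :
    IsInexactRun Q.penalty Q.constraintMap (WithLp.toLp 2 (Q.b, Q.d)) Q.slackSet |B|
      (fun k => lam (k + 1)) (fun k => 2 * tau (k + 1)) (fun k => xi (k + 1))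
      (fun k => (X (k + 1), s (k + 1))) (fun k => WithLp.toLp 2 (y (k + 1), 0))
      (fun k => WithLp.toLp 2 (θ₁ (k + 1), θ₂ (k + 1))) where
  mem k := ⟨hball _ k.succ_pos, rfl⟩
  approx k := by
    have hk := hlam _ k.succ_pos
    have hB : eps (k + 1) ≤ |B| * lam (k + 1) ^ 2 :=
      (div_le_iff₀ (pow_pos hk 2)).1 ((heps _ k.succ_pos).trans (le_abs_self B))
    exact (hdone _ k.succ_pos).imp (fun ha => ha.isApproxMinimizer.mono hB)
      fun hb => hb.isApproxStationary
  update k := by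
    rw [hupdate₁ _ k.succ_pos, hupdate₂ _ k.succ_pos]
    simp only [multiplierUpdate, constraintMap_apply, ← WithLp.toLp_add, ← WithLp.toLp_sub,
      ← WithLp.toLp_smul, Prod.mk_add_mk, Prod.mk_sub_mk, Prod.smul_mk, add_zero]

theorem tendsto_of_isInexactRun [Fact (1 ≤ Q.α)] [Fact (1 ≤ Q.β)] [Fact (1 ≤ Q.γ)]
    (hμ₁ : 0 ≤ Q.μ₁) (hμ₂ : 0 ≤ Q.μ₂) (hA : Function.Surjective Q.A)
    {Xstar : Matrix (Fin m) (Fin n) ℝ} (hopt : Q.IsOptimal Xstar)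
    (hunique : ∀ Y, Q.IsOptimal Y → Y = Xstar) {lam tau xi : ℕ → ℝ}
    {X : ℕ → Matrix (Fin m) (Fin n) ℝ} {s : ℕ → EuclideanSpace ℝ (Fin p)}
    {w θ : ℕ → WithLp 2 (EuclideanSpace ℝ (Fin q) × EuclideanSpace ℝ (Fin p))}
    (h : IsInexactRun Q.penalty Q.constraintMap (WithLp.toLp 2 (Q.b, Q.d)) Q.slackSet B
      lam tau xi (fun k => (X k, s k)) w θ) (hB : 0 ≤ B) (hlam : ∀ k, 0 < lam k)
    (hlam₀ : Tendsto lam atTop (𝓝 0)) (htau : Tendsto (fun k => tau k / lam k) atTop (𝓝 0))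
    (hxi : Tendsto (fun k => xi k / lam k) atTop (𝓝 0)) :
    Tendsto X atTop (𝓝 Xstar) := by
  obtain ⟨f, hf⟩ := Q.exists_seminorm_eq_penalty hμ₁ hμ₂
  obtain ⟨L, hL⟩ := exists_lipschitzWith_seminorm f
  have hconv : ConvexOn ℝ Set.univ Q.penalty := hf ▸ f.convexOn
  have hfeas : WithLp.toLp 2 (Q.b, Q.d) - Q.constraintMap (Xstar, Q.d - Q.C Xstar) ∈ Q.slackSet :=
    sub_constraintMap_mem_slackSet_iff.2 ⟨hopt.1, rfl⟩
  have hlim := h.tendsto (hf ▸ hL) hconv Q.isClosed_slackSet Q.convex_slackSet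
    (Q.constraintMap_surjective hA) hfeas (fun _ => hopt.eq_of_penalty_le hunique) hB hlam hlam₀
    htau hxi
  exact (continuous_fst.tendsto _).comp hlim

end Problem

end CompositeNorm

theorem one_le_of_eq {r : ℝ≥0∞} (hr : r = 1 ∨ r = 2 ∨ r = ∞) : 1 ≤ r := by
  rcases hr with rfl | rfl | rfl
  exacts [le_rfl, one_le_two, le_top]

end FALC

end

theorem corollary1_general {m n p q : ℕ} (Q : FALC.Problem m n p q)
    (hα : 1 ≤ Q.α) (hβ : 1 ≤ Q.β) (hγ : 1 ≤ Q.γ) (hμ₁ : 0 ≤ Q.μ₁) (hμ₂ : 0 ≤ Q.μ₂)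
    (hA : Function.Surjective Q.A)
    (Xstar : Matrix (Fin m) (Fin n) ℝ) (hopt : Q.IsOptimal Xstar)
    (hunique : ∀ Y : Matrix (Fin m) (Fin n) ℝ, Q.IsOptimal Y → Y = Xstar)
    (lam eps tau xi eta : ℕ → ℝ) (B : ℝ) (hlam : ∀ k, 1 ≤ k → 0 < lam k)
    (hlam₀ : Tendsto lam atTop (𝓝 0)) (heps : ∀ k, 1 ≤ k → eps k / lam k ^ 2 ≤ B)
    (htau : Tendsto (fun k => tau k / lam k) atTop (𝓝 0))
    (hxi : Tendsto (fun k => xi k / lam k) atTop (𝓝 0))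
    (X : ℕ → Matrix (Fin m) (Fin n) ℝ) (s : ℕ → EuclideanSpace ℝ (Fin p))
    (y : ℕ → EuclideanSpace ℝ (Fin q))
    (θ₁ : ℕ → EuclideanSpace ℝ (Fin q)) (θ₂ : ℕ → EuclideanSpace ℝ (Fin p))
    (hball : ∀ k, 1 ≤ k → FALC.vecNorm Q.γ (y k).ofLp ≤ Q.ρ)
    (hdone : ∀ k, 1 ≤ k →
      Q.StopA (lam k) (eps k) (θ₁ k) (θ₂ k) (X k) (s k) (y k) ∨
      Q.StopB (lam k) (tau k) (xi k) (eta k) (θ₁ k) (θ₂ k) (X k) (s k) (y k))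
    (hupdate₁ : ∀ k, 1 ≤ k → θ₁ (k + 1) = θ₁ k - (lam k)⁻¹ • (Q.A (X k) + y k - Q.b))
    (hupdate₂ : ∀ k, 1 ≤ k → θ₂ (k + 1) = θ₂ k - (lam k)⁻¹ • (Q.C (X k) + s k - Q.d)) :
    Tendsto X atTop (𝓝 Xstar) := by
  have : Fact (1 ≤ Q.α) := ⟨hα⟩
  have : Fact (1 ≤ Q.β) := ⟨hβ⟩
  have : Fact (1 ≤ Q.γ) := ⟨hγ⟩
  have hrun := FALC.Problem.isInexactRun_of_stop hlam heps hball hdone hupdate₁ hupdate₂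
  have hratio : Tendsto (fun k => 2 * tau (k + 1) / lam (k + 1)) atTop (𝓝 0) := by
    simpa only [mul_div_assoc, mul_zero] using ((tendsto_add_atTop_iff_nat 1).2 htau).const_mul 2
  refine (tendsto_add_atTop_iff_nat 1).1 ?_
  exact FALC.Problem.tendsto_of_isInexactRun hμ₁ hμ₂ hA hopt hunique hrun (abs_nonneg B)
    (fun k => hlam _ k.succ_pos) ((tendsto_add_atTop_iff_nat 1).2 hlam₀) hratio
    ((tendsto_add_atTop_iff_nat 1).2 hxi)

theorem corollary1 {m n p q : ℕ} (Q : FALC.Problem m n p q)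
    (hα : Q.α = 1 ∨ Q.α = 2 ∨ Q.α = ∞) (hβ : Q.β = 1 ∨ Q.β = 2 ∨ Q.β = ∞)
    (hγ : Q.γ = 1 ∨ Q.γ = 2 ∨ Q.γ = ∞)
    (hμ₁ : 0 ≤ Q.μ₁) (hμ₂ : 0 ≤ Q.μ₂)
    (hA : Function.Surjective Q.A)
    (Xstar : Matrix (Fin m) (Fin n) ℝ) (hopt : Q.IsOptimal Xstar)
    (hunique : ∀ Y : Matrix (Fin m) (Fin n) ℝ, Q.IsOptimal Y → Y = Xstar)
    (lam eps tau xi : ℕ → ℝ) (hparam : FALC.ParamConditions lam eps tau xi)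
    (X : ℕ → Matrix (Fin m) (Fin n) ℝ) (s : ℕ → EuclideanSpace ℝ (Fin p))
    (y : ℕ → EuclideanSpace ℝ (Fin q))
    (θ₁ : ℕ → EuclideanSpace ℝ (Fin q)) (θ₂ : ℕ → EuclideanSpace ℝ (Fin p))
    (hrun : Q.IsRun lam eps tau xi X s y θ₁ θ₂) :
    Tendsto X atTop (𝓝 Xstar) := by
  obtain ⟨B, -, hB⟩ := hparam.eps_bound
  exact corollary1_general Q (FALC.one_le_of_eq hα) (FALC.one_le_of_eq hβ) (FALC.one_le_of_eq hγ)
    hμ₁ hμ₂ hA Xstar hopt hunique lam eps tau xi _ B hparam.lam_pos hparam.lam_decr.2 hB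
    hparam.tau_ratio hparam.xi_ratio X s y θ₁ θ₂ hrun.mem_ball hrun.inner_done hrun.update₁
    hrun.update₂
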